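/- Setting. Let $(\Gamma,d)$ be a countable metric space. To each $x\in\Gamma$ a finite-dimensional complex Hilbert space $\mathcal H_x$ is attached; for finite $\Lambda\subset\Gamma$ put $\mathcal H_\Lambda=\bigotimes_{x\in\Lambda}\mathcal H_x$ and $\mathcal A_\Lambda=\mathcal B(\mathcal H_\Lambda)$ with the operator norm, and for $\Lambda_0\subset\Lambda$ identify $A\in\mathcal A_{\Lambda_0}$ with $A\otimes 1_{\Lambda\setminus\Lambda_0}\in\mathcal A_\Lambda$. For $Z \subset \Lambda$, a linear map $\Phi$ on $\mathcal A_Z$ acts on $\mathcal A_\Lambda$ as $\Phi\otimes\mathrm{id}_{\Lambda\setminus Z}$, and $\|\Phi\|_{cb}=\sup_{k\in\mathbb N}\|\Phi\otimes\mathrm{id}_{\mathbb M_k}\|$. A dissipative interaction is a family $\mathscr L=\{L_Z\}$, indexed by the finite sets $Z\subset\Gamma$, of linear maps $L_Z:\mathcal A_Z\to\mathcal A_Z$ of Lindblad form: there are $H_Z=H_Z^*\in\mathcal A_Z$, $\ell_Z \in \mathbb N$ and $K_1,\dots,K_{\ell_Z}\in\mathcal A_Z$ with $L_Z(A)=i[H_Z,A]+\sum_{j=1}^{\ell_Z}\big(K_j^*AK_j-\tfrac12\{K_j^*K_j,A\}\big)$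 for all $A\in\mathcal A_Z$. For finite $\Lambda \subset \Gamma$ and $t\ge 0$ set $\mathscr L^\Lambda=\sum_{Z\subset\Lambda}L_Z$ and $T_t^\Lambda=e^{t\mathscr L^\Lambda}$. An $F$-function on $(\Gamma,d)$ is a non-increasing $F:[0,\infty)\to(0,\infty)$ with $\|F\|=\sup_{x}\sum_{y}F(d(x,y))<\infty$ such that for some $C>0$ one has $\sum_{z}F(d(x,z))F(d(z,y))\le C\,F(d(x,y))$ for all $x,y\in\Gamma$; $C_F$ is the infimum of all such $C$. Let $\|\mathscr L\|_F$ be the infimum of all $M$ with $\sum_{Z\ni x,y}\|L_Z\|_{cb}\le M\,F(d(x,y))$ for all $x,y\in\Gamma$ (the sum is over finite $Z \subset \Gamma$). Theorem. Let $F$ be an $F$-function on $(\Gamma,d)$ and $\mathscr L$ a dissipative interaction with $\|\mathscr L\|_F<\infty$. Let $X\subset\Lambda\subset\Gamma$ be finite sets and $A\in\mathcal A_X$. For $r\ge 1$ let $X(r)=\{y\in\Lambda: d(y,x)\le r\text{ for some }x\in X\}$ be the $r$-inflation of $X$ inside $\Lambda$. Then, for all $t\ge0$ and $r\ge1$, $$\|T_t^\Lambda(A)-T_t^{X(r)}(A)\|\le\|A\|\,\|\mathscr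 L\|_F\Big(t+\frac{C_F+\|F\|}{C_F}\int_0^t(e^{vs}-1)\,ds\Big)\sum_{x\in X}\ \sum_{y\in\Lambda\setminus X(r)}F(d(x,y)),$$ where $v=\|\mathscr L\|_F\,C_F$. -/

import Mathlib

open scoped ENNReal Matrix.Norms.L2Operator Kronecker

noncomputable section

namespace QSpin

/-! ### Completely bounded norm and Lindblad form on a full matrix algebra

`Matrix m m ℂ` carries the operator norm of `B(ℂ^m)`, that is, its C⋆-norm. -/

/-- The map `Φ ⊗ id` on `B(ℂ^m) ⊗ B(ℂ^κ) = B(ℂ^(m × κ))`: a matrix over `m × κ` is read as a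
`κ × κ` matrix with entries in `B(ℂ^m)`, and `Φ` acts on every entry. -/
def ampliation {m : Type*} (κ : Type*) (Φ : Matrix m m ℂ →ₗ[ℂ] Matrix m m ℂ) :
    Matrix (m × κ) (m × κ) ℂ →ₗ[ℂ] Matrix (m × κ) (m × κ) ℂ where
  toFun M := Matrix.of fun p q => Φ (Matrix.of fun a b => M (a, p.2) (b, q.2)) p.1 q.1
  map_add' M N := by
    ext p q
    exact congrFun (congrFun (Φ.map_add (Matrix.of fun a b => M (a, p.2) (b, q.2))
      (Matrix.of fun a b => N (a, p.2) (b, q.2))) p.1) q.1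
  map_smul' c M := by
    ext p q
    exact congrFun (congrFun (Φ.map_smul c (Matrix.of fun a b => M (a, p.2) (b, q.2))) p.1) q.1

/-- The completely bounded norm `‖Φ‖_cb = sup_k ‖Φ ⊗ 1_{k × k}‖`. -/
def cbNorm {m : Type*} [Fintype m] [DecidableEq m] (Φ : Matrix m m ℂ →ₗ[ℂ] Matrix m m ℂ) :
    ℝ≥0∞ :=
  ⨆ k : ℕ, ‖LinearMap.toContinuousLinearMap (ampliation (Fin k) Φ)‖ₑ

/-- `Φ` is of Lindblad form:
`Φ(A) = i[H, A] + ∑ⱼ (Kⱼ* A Kⱼ - ½ {Kⱼ* Kⱼ, A})` with `H = H*` and finitely many `Kⱼ`. -/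
def IsLindblad {m : Type*} [Fintype m] (Φ : Matrix m m ℂ →ₗ[ℂ] Matrix m m ℂ) : Prop :=
  ∃ (H : Matrix m m ℂ) (ℓ : ℕ) (K : Fin ℓ → Matrix m m ℂ), IsSelfAdjoint H ∧
    ∀ A : Matrix m m ℂ,
      Φ A = Complex.I • (H * A - A * H) +
        ∑ j, (star (K j) * A * K j
          - (1 / 2 : ℂ) • (star (K j) * K j * A + A * (star (K j) * K j)))

/-! ### Quantum spin systems

The Hilbert space at the site `x` is `ℂ^(q x)`. -/

/-- Labels of the product orthonormal basis of `H_Λ = ⨂_{x ∈ Λ} ℂ^(q x)`. -/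
abbrev Conf {Γ : Type*} (q : Γ → ℕ) (Λ : Finset Γ) : Type _ := (x : Λ) → Fin (q x)

/-- The algebra of observables `A_Λ = B(H_Λ)`, `H_Λ = ⨂_{x ∈ Λ} ℂ^(q x)`, with its operator norm. -/
abbrev Obs {Γ : Type*} (q : Γ → ℕ) (Λ : Finset Γ) : Type _ := Matrix (Conf q Λ) (Conf q Λ) ℂ

/-- The decomposition `H_Λ = H_Z ⊗ H_{Λ ∖ Z}` for `Z ⊆ Λ`, on the level of basis labels. -/
def splitConf {Γ : Type*} [DecidableEq Γ] (q : Γ → ℕ) {Z Λ : Finset Γ} (h : Z ⊆ Λ) :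
    Conf q Λ ≃ Conf q Z × Conf q (Λ \ Z) where
  toFun σ := (fun x => σ ⟨x.1, h x.2⟩, fun x => σ ⟨x.1, (Finset.mem_sdiff.1 x.2).1⟩)
  invFun p := fun x =>
    if hx : x.1 ∈ Z then p.1 ⟨x.1, hx⟩ else p.2 ⟨x.1, Finset.mem_sdiff.2 ⟨x.2, hx⟩⟩
  left_inv σ := by
    funext x
    by_cases hx : x.1 ∈ Z <;> simp [hx]
  right_inv p := by
    refine Prod.ext ?_ ?_
    · funext x
      simp [x.2]
    · funext x
      have hx : x.1 ∉ Z := (Finset.mem_sdiff.1 x.2).2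
      simp [hx]

/-- The inclusion `A_Z ⊆ A_Λ`, `A ↦ A ⊗ 1_{Λ ∖ Z}`, for `Z ⊆ Λ`. -/
def embed {Γ : Type*} [DecidableEq Γ] (q : Γ → ℕ) {Z Λ : Finset Γ} (h : Z ⊆ Λ) (A : Obs q Z) :
    Obs q Λ :=
  Matrix.reindex (splitConf q h).symm (splitConf q h).symm
    (A ⊗ₖ (1 : Matrix (Conf q (Λ \ Z)) (Conf q (Λ \ Z)) ℂ))

/-- The map `Φ ⊗ id_{Λ ∖ Z}` on `A_Λ` for a linear map `Φ` on `A_Z` and `Z ⊆ Λ`. -/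
def extend {Γ : Type*} [DecidableEq Γ] (q : Γ → ℕ) {Z Λ : Finset Γ} (h : Z ⊆ Λ)
    (Φ : Obs q Z →ₗ[ℂ] Obs q Z) : Obs q Λ →ₗ[ℂ] Obs q Λ :=
  (Matrix.reindexLinearEquiv ℂ ℂ (splitConf q h).symm (splitConf q h).symm).toLinearMap ∘ₗ
    ampliation (Conf q (Λ \ Z)) Φ ∘ₗ
      (Matrix.reindexLinearEquiv ℂ ℂ (splitConf q h) (splitConf q h)).toLinearMap

/-- A dissipative interaction: a map `L_Z` of Lindblad form on `A_Z` for every finite `Z ⊆ Γ`. -/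
structure Interaction {Γ : Type*} [DecidableEq Γ] (q : Γ → ℕ) where
  /-- The local term `L_Z`. -/
  term : ∀ Z : Finset Γ, Obs q Z →ₗ[ℂ] Obs q Z
  lindblad : ∀ Z, IsLindblad (term Z)

/-- The finite-volume generator `∑_{Z ⊆ Λ} L_Z` on `A_Λ`. -/
def generator {Γ : Type*} [DecidableEq Γ] {q : Γ → ℕ} (L : Interaction q) (Λ : Finset Γ) :
    Obs q Λ →L[ℂ] Obs q Λ :=
  LinearMap.toContinuousLinearMap
    (∑ Z ∈ Λ.powerset.attach, extend q (Finset.mem_powerset.1 Z.2) (L.term Z.1))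

/-- The finite-volume dynamics `T_t^Λ`, the exponential of `t` times the generator. -/
def dynamics {Γ : Type*} [DecidableEq Γ] {q : Γ → ℕ} (L : Interaction q) (Λ : Finset Γ) (t : ℝ) :
    Obs q Λ →L[ℂ] Obs q Λ :=
  NormedSpace.exp ((t : ℂ) • generator L Λ)

/-! ### Decay functions -/

/-- `‖F‖ = sup_x ∑_y F(d(x, y))`. -/
def decayNorm (Γ : Type*) [MetricSpace Γ] (F : ℝ → ℝ) : ℝ≥0∞ :=
  ⨆ x : Γ, ∑' y : Γ, ENNReal.ofReal (F (dist x y))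

/-- `C` is an admissible constant in the convolution condition
`∑_z F(d(x, z)) F(d(z, y)) ≤ C F(d(x, y))`. -/
def IsConvBound (Γ : Type*) [MetricSpace Γ] (F : ℝ → ℝ) (C : ℝ) : Prop :=
  0 < C ∧ ∀ x y : Γ,
    ∑' z : Γ, ENNReal.ofReal (F (dist x z) * F (dist z y)) ≤ ENNReal.ofReal (C * F (dist x y))

/-- The convolution constant `C_F`. -/
def convConst (Γ : Type*) [MetricSpace Γ] (F : ℝ → ℝ) : ℝ :=
  sInf {C : ℝ | IsConvBound Γ F C}

/-- `F : [0, ∞) → (0, ∞)` is an `F`-function on `Γ`; only its values on `[0, ∞)` matter. -/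
structure IsDecayFunction (Γ : Type*) [MetricSpace Γ] (F : ℝ → ℝ) : Prop where
  pos : ∀ r, 0 ≤ r → 0 < F r
  antitone : AntitoneOn F (Set.Ici 0)
  summable : decayNorm Γ F < ∞
  conv : ∃ C : ℝ, IsConvBound Γ F C

/-- The `F`-norm of an interaction, the infimum of all `M` with
`∑_{Z ∋ x, y} ‖L_Z‖_cb ≤ M F(d(x, y))` for all `x, y`; it is `∞` if there is no such finite `M`. -/
def interactionNorm {Γ : Type*} [MetricSpace Γ] [DecidableEq Γ] {q : Γ → ℕ} (F : ℝ → ℝ)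
    (L : Interaction q) : ℝ≥0∞ :=
  sInf {M : ℝ≥0∞ | ∀ x y : Γ,
    ∑' Z : {Z : Finset Γ // x ∈ Z ∧ y ∈ Z}, cbNorm (L.term Z.1) ≤
      M * ENNReal.ofReal (F (dist x y))}

open Classical in
/-- The part `X(r) ∩ Λ` of the inflation `X(r) = {y | d(y, x) ≤ r for some x ∈ X}` inside `Λ`. -/
def inflate {Γ : Type*} [MetricSpace Γ] (Λ X : Finset Γ) (r : ℝ) : Finset Γ :=
  Λ.filter fun y => ∃ x ∈ X, dist y x ≤ r

theorem inflate_subset {Γ : Type*} [MetricSpace Γ] (Λ X : Finset Γ) (r : ℝ) :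
    inflate Λ X r ⊆ Λ :=
  Finset.filter_subset _ _

theorem subset_inflate {Γ : Type*} [MetricSpace Γ] {Λ X : Finset Γ} (h : X ⊆ Λ) {r : ℝ}
    (hr : 1 ≤ r) : X ⊆ inflate Λ X r := fun x hx =>
  Finset.mem_filter.2 ⟨h hx, x, hx, by rw [dist_self]; linarith⟩

end QSpin

end

noncomputable section

namespace QSpin

open Filter Topology Asymptotics

section LocalAlgebra

variable {Γ : Type*} [DecidableEq Γ] {q : Γ → ℕ}

/-! ### The inclusions of local algebras -/

/-! Write `Y` for the inflation of `X`, `M` for the interaction norm, `C` for the convolution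
constant. Inside the algebra of `Λ`, Duhamel's formula represents the difference of the two
evolutions as the integral over `s` of `T^Y_{t-s}` applied to the sum of `L_Z T^Λ_s(A)` over `Z ⊆ Λ`
with `Z ⊄ Y`. As `T^Y` is a contraction, it suffices to bound each `‖L_Z T^Λ_s(A)‖`; this is the
Lieb–Robinson bound `norm_local_term_evolution_le`. The vector `L_Z T^Λ_s(A)` solves a linear
equation whose homogeneous part is generated by the terms disjoint from `Z`, which commute with
`L_Z`; the forcing is `L_Z` applied to the terms `L_{Z'} T^Λ_s(A)` with `Z'` meeting `Z`. The
resulting system of integral inequalities is solved by `‖A‖ ‖L_Z‖_cb` times `lrWeight` with `κ(s) =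
(e^{MCs} - 1)/C`, because `κ' = M(1 + κC)` is the factor that `sum_lrWeight_le` produces. Summing
over the `Z` that meet `Λ \ Y` bounds the difference by `‖A‖ κ(t) ∑∑ F`, and `κ(t)` is at most the
constant in the theorem. Contractivity is needed for arbitrary partial sums of local terms. It comes
from dissipativity, tested at norming vectors (`isDissipative_lindbladian`), so complete positivity
plays no role. -/

theorem embed_apply {Z Λ : Finset Γ} (h : Z ⊆ Λ) (A : Obs q Z) (σ τ : Conf q Λ) :
    embed q h A σ τ = A (splitConf q h σ).1 (splitConf q h τ).1 *
      (1 : Matrix (Conf q (Λ \ Z)) (Conf q (Λ \ Z)) ℂ) (splitConf q h σ).2 (splitConf q h τ).2 :=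
  rfl

/-- The inclusion `A_Z ⊆ A_Λ` as a unital ⋆-homomorphism. -/
def embedHom (q : Γ → ℕ) {Z Λ : Finset Γ} (h : Z ⊆ Λ) : Obs q Z →⋆ₐ[ℂ] Obs q Λ where
  toFun := embed q h
  map_one' := by simp [embed]
  map_mul' A B := by
    have := Matrix.mul_kronecker_mul A B (1 : Obs q (Λ \ Z)) (1 : Obs q (Λ \ Z))
    rw [mul_one] at this
    simp only [embed, this]
    exact map_mul (Matrix.reindexAlgEquiv ℂ ℂ (splitConf q h).symm) _ _
  map_zero' := by simp [embed]
  map_add' A B := by simp [embed, Matrix.add_kronecker]; rfl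
  commutes' c := by
    simp only [embed, Algebra.algebraMap_eq_smul_one, Matrix.smul_kronecker, Matrix.one_kronecker_one]
    exact (map_smul (Matrix.reindexAlgEquiv ℂ ℂ (splitConf q h).symm) c 1).trans (by simp)
  map_star' A := by
    have := Matrix.conjTranspose_kronecker A (1 : Matrix (Conf q (Λ \ Z)) (Conf q (Λ \ Z)) ℂ)
    simp only [embed, Matrix.star_eq_conjTranspose, Matrix.conjTranspose_reindex, this,
      Matrix.conjTranspose_one]

@[simp] theorem embedHom_apply {Z Λ : Finset Γ} (h : Z ⊆ Λ) (A : Obs q Z) :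
    embedHom q h A = embed q h A := rfl

theorem norm_embed_le {Z Λ : Finset Γ} (h : Z ⊆ Λ) (A : Obs q Z) : ‖embed q h A‖ ≤ ‖A‖ :=
  NonUnitalStarAlgHom.norm_apply_le (embedHom q h) A

theorem embed_trans {Z Y Λ : Finset Γ} (h : Z ⊆ Y) (h' : Y ⊆ Λ) (A : Obs q Z) :
    embed q h' (embed q h A) = embed q (h.trans h') A := by
  ext σ τ
  simp only [embed_apply, Matrix.one_apply, ← ite_and, mul_ite, mul_one, mul_zero]
  refine if_congr ?_ rfl rfl
  simp only [splitConf, Equiv.coe_fn_mk, funext_iff, Subtype.forall, Finset.mem_sdiff]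
  constructor
  · rintro ⟨h2, h1⟩ x ⟨hx, hxZ⟩
    by_cases hY : x ∈ Y
    · exact h1 x ⟨hY, hxZ⟩
    · exact h2 x ⟨hx, hY⟩
  · intro H
    exact ⟨fun x hx => H x ⟨hx.1, fun hZ => hx.2 (h hZ)⟩, fun x hx => H x ⟨h' hx.1, hx.2⟩⟩

/-- Places an observable supported off `Z` on the second factor of the splitting along `Z`, so that
commutation reduces to that of `A ⊗ 1` and `1 ⊗ B`. -/
theorem embed_eq_one_kronecker {Z Z' Λ : Finset Γ} (h : Z ⊆ Λ) (h' : Z' ⊆ Λ) (hd : Z' ⊆ Λ \ Z)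
    (A : Obs q Z') :
    embed q h' A = Matrix.reindex (splitConf q h).symm (splitConf q h).symm
      ((1 : Obs q Z) ⊗ₖ embed q hd A) := by
  ext σ τ
  simp only [Matrix.reindex_apply, Equiv.symm_symm, Matrix.submatrix_apply,
    Matrix.kroneckerMap_apply, embed_apply, Matrix.one_apply, ite_mul, one_mul, zero_mul,
    mul_ite, mul_one, mul_zero, ← ite_and]
  refine if_congr ?_ rfl rfl
  simp only [splitConf, Equiv.coe_fn_mk, funext_iff, Subtype.forall, Finset.mem_sdiff]
  constructor
  · intro H
    exact ⟨fun x hx => H x ⟨hx.1.1, hx.2⟩,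
      fun x hx => H x ⟨h hx, fun hZ => (Finset.mem_sdiff.1 (hd hZ)).2 hx⟩⟩
  · rintro ⟨h2, h1⟩ x ⟨hx, hxZ⟩
    by_cases hY : x ∈ Z
    · exact h1 x hY
    · exact h2 x ⟨⟨hx, hY⟩, hxZ⟩

/-- Observables with disjoint supports commute. -/
theorem embed_commute {Z Z' Λ : Finset Γ} (h : Z ⊆ Λ) (h' : Z' ⊆ Λ) (hd : Disjoint Z Z')
    (A : Obs q Z) (B : Obs q Z') : Commute (embed q h A) (embed q h' B) := by
  have hs : Z' ⊆ Λ \ Z := fun x hx =>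
    Finset.mem_sdiff.2 ⟨h' hx, fun hZ => Finset.disjoint_left.1 hd hZ hx⟩
  rw [embed_eq_one_kronecker h h' hs]
  unfold embed
  have e1 := Matrix.mul_kronecker_mul A (1 : Obs q Z) (1 : Obs q (Λ \ Z)) (embed q hs B)
  have e2 := Matrix.mul_kronecker_mul (1 : Obs q Z) A (embed q hs B) (1 : Obs q (Λ \ Z))
  simp only [mul_one, one_mul] at e1 e2
  change Matrix.reindexAlgEquiv ℂ ℂ (splitConf q h).symm _ *
    Matrix.reindexAlgEquiv ℂ ℂ (splitConf q h).symm _ =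
    Matrix.reindexAlgEquiv ℂ ℂ (splitConf q h).symm _ *
    Matrix.reindexAlgEquiv ℂ ℂ (splitConf q h).symm _
  rw [← map_mul, ← map_mul]
  exact congrArg _ (e1.symm.trans e2)

/-! ### Extensions of local maps -/

theorem ampliation_mulLeftRight {m κ : Type*} [Fintype m] [Fintype κ] [DecidableEq κ]
    [DecidableEq m]
    (P Q : Matrix m m ℂ) (M : Matrix (m × κ) (m × κ) ℂ) :
    ampliation κ (LinearMap.mulLeftRight ℂ (P, Q)) M =
      (P ⊗ₖ (1 : Matrix κ κ ℂ)) * M * (Q ⊗ₖ (1 : Matrix κ κ ℂ)) := by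
  ext ⟨a, i⟩ ⟨b, j⟩
  simp [ampliation, Matrix.mul_apply, Fintype.sum_prod_type, Matrix.one_apply]

/-- `Φ ↦ Φ ⊗ id_{Λ ∖ Z}` as a linear map. -/
def extendLin (q : Γ → ℕ) {Z Λ : Finset Γ} (h : Z ⊆ Λ) :
    (Obs q Z →ₗ[ℂ] Obs q Z) →ₗ[ℂ] Obs q Λ →ₗ[ℂ] Obs q Λ where
  toFun := extend q h
  map_add' _ _ := rfl
  map_smul' _ _ := rfl

/-- Maps of Lindblad form are linear combinations of the maps `A ↦ P A Q`, so this case determines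
their extensions. -/
theorem extend_mulLeftRight {Z Λ : Finset Γ} (h : Z ⊆ Λ) (P Q : Obs q Z) (M : Obs q Λ) :
    extend q h (LinearMap.mulLeftRight ℂ (P, Q)) M = embed q h P * M * embed q h Q := by
  let ρ := Matrix.reindexAlgEquiv ℂ ℂ (splitConf q h).symm
  have hM : M = ρ (Matrix.reindex (splitConf q h) (splitConf q h) M) := by
    ext; simp [ρ]
  have hl : extend q h (LinearMap.mulLeftRight ℂ (P, Q)) M =
      ρ (ampliation _ (LinearMap.mulLeftRight ℂ (P, Q))
        (Matrix.reindex (splitConf q h) (splitConf q h) M)) := rfl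
  have hP : ∀ R, embed q h R = ρ (R ⊗ₖ (1 : Obs q (Λ \ Z))) := fun R => rfl
  rw [hl, ampliation_mulLeftRight, hP, hP, map_mul, map_mul, ← hM]

/-- The map `A ↦ i[H, A] + ∑ⱼ (Kⱼ* A Kⱼ - ½ {Kⱼ* Kⱼ, A})`. -/
def lindbladian {m : Type*} [Fintype m] (H : Matrix m m ℂ) {ℓ : ℕ} (K : Fin ℓ → Matrix m m ℂ)
    (A : Matrix m m ℂ) : Matrix m m ℂ :=
  Complex.I • (H * A - A * H) + ∑ j, (star (K j) * A * K j
    - (1 / 2 : ℂ) • (star (K j) * K j * A + A * (star (K j) * K j)))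

theorem extend_lindbladian {Z Λ : Finset Γ} (h : Z ⊆ Λ) {Φ : Obs q Z →ₗ[ℂ] Obs q Z}
    {H : Obs q Z} {ℓ : ℕ} {K : Fin ℓ → Obs q Z} (hΦ : ∀ A, Φ A = lindbladian H K A)
    (M : Obs q Λ) :
    extend q h Φ M = lindbladian (embed q h H) (fun j => embed q h (K j)) M := by
  have e : Φ = Complex.I • (LinearMap.mulLeftRight ℂ (H, 1) - LinearMap.mulLeftRight ℂ (1, H)) +
      ∑ j, (LinearMap.mulLeftRight ℂ (star (K j), K j) - (1 / 2 : ℂ) •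
        (LinearMap.mulLeftRight ℂ (star (K j) * K j, 1) +
          LinearMap.mulLeftRight ℂ (1, star (K j) * K j))) := by
    ext1 A
    simp [hΦ, lindbladian]
  have e' := congrArg (fun Ψ => extendLin q h Ψ M) e
  simp only [map_add, map_smul, map_sub, map_sum] at e'
  simp only [LinearMap.add_apply, LinearMap.smul_apply, LinearMap.sub_apply, LinearMap.sum_apply]
    at e'
  have hx : ∀ Ψ, extendLin q h Ψ = extend q h Ψ := fun _ => rfl
  simp only [hx, extend_mulLeftRight, ← embedHom_apply, map_mul, map_one, map_star, one_mul,
    mul_one] at e'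
  rw [e']
  rfl

theorem embed_lindbladian {Z Λ : Finset Γ} (h : Z ⊆ Λ)
    (H : Obs q Z) {ℓ : ℕ} (K : Fin ℓ → Obs q Z) (A : Obs q Z) :
    embed q h (lindbladian H K A) =
      lindbladian (embed q h H) (fun j => embed q h (K j)) (embed q h A) := by
  simp only [lindbladian, ← embedHom_apply, map_mul, map_add, map_sub, map_smul, map_sum, map_star]

theorem IsLindblad.exists_lindbladian {m : Type*} [Fintype m]
    {Φ : Matrix m m ℂ →ₗ[ℂ] Matrix m m ℂ} (h : IsLindblad Φ) :
    ∃ (H : Matrix m m ℂ) (ℓ : ℕ) (K : Fin ℓ → Matrix m m ℂ), IsSelfAdjoint H ∧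
      ∀ A, Φ A = lindbladian H K A := h

theorem IsLindblad.extend {Z Λ : Finset Γ} (h : Z ⊆ Λ) {Φ : Obs q Z →ₗ[ℂ] Obs q Z}
    (hΦ : IsLindblad Φ) : IsLindblad (extend q h Φ) := by
  obtain ⟨H, ℓ, K, hH, hΦ⟩ := hΦ.exists_lindbladian
  exact ⟨embed q h H, ℓ, fun j => embed q h (K j), hH.map (embedHom q h),
    extend_lindbladian h hΦ⟩

/-- Both sides are the Lindbladian with the same operators embedded in `Λ`. It makes the inclusion
intertwine the generator of `Y` with a partial sum of local terms on `Λ`. -/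
theorem embed_extend {Z Y Λ : Finset Γ} (h : Z ⊆ Y) (h' : Y ⊆ Λ) {Φ : Obs q Z →ₗ[ℂ] Obs q Z}
    (hΦ : IsLindblad Φ) (A : Obs q Y) :
    embed q h' (QSpin.extend q h Φ A) = QSpin.extend q (h.trans h') Φ (embed q h' A) := by
  obtain ⟨H, ℓ, K, -, hΦ⟩ := hΦ.exists_lindbladian
  rw [extend_lindbladian h hΦ, extend_lindbladian (h.trans h') hΦ, embed_lindbladian]
  simp only [embed_trans]

/-- The commutator vanishes, and `K* A K = K* K A = A K* K` cancels against the two halves of the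
anticommutator. -/
theorem lindbladian_eq_zero {m : Type*} [Fintype m] {H : Matrix m m ℂ} {ℓ : ℕ}
    {K : Fin ℓ → Matrix m m ℂ} {A : Matrix m m ℂ} (hH : Commute H A)
    (hK : ∀ j, Commute (K j) A) (hK' : ∀ j, Commute (star (K j)) A) : lindbladian H K A = 0 := by
  have e : ∀ j, star (K j) * A * K j - (1 / 2 : ℂ) • (star (K j) * K j * A + A * (star (K j) * K j))
      = 0 := fun j => by
    rw [← ((hK' j).mul_left (hK j)).eq, mul_assoc, ← (hK j).eq, ← mul_assoc, ← two_smul ℂ,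
      smul_smul]
    norm_num
  unfold lindbladian
  rw [hH.eq, sub_self, smul_zero, zero_add, Finset.sum_eq_zero fun j _ => e j]

theorem extend_embed_of_disjoint {Z X Λ : Finset Γ} (h : Z ⊆ Λ) (hX : X ⊆ Λ) (hd : Disjoint Z X)
    {Φ : Obs q Z →ₗ[ℂ] Obs q Z} (hΦ : IsLindblad Φ) (A : Obs q X) :
    QSpin.extend q h Φ (embed q hX A) = 0 := by
  obtain ⟨H, ℓ, K, -, hΦ⟩ := hΦ.exists_lindbladian
  rw [extend_lindbladian h hΦ]
  refine lindbladian_eq_zero (embed_commute h hX hd _ _) (fun j => embed_commute h hX hd _ _)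
    fun j => ?_
  rw [← embedHom_apply, ← map_star]
  exact embed_commute h hX hd _ _

theorem mul_lindbladian {m : Type*} [Fintype m] {H : Matrix m m ℂ} {ℓ : ℕ}
    {K : Fin ℓ → Matrix m m ℂ} {P : Matrix m m ℂ} (hH : Commute P H)
    (hK : ∀ j, Commute P (K j)) (hK' : ∀ j, Commute P (star (K j))) (A : Matrix m m ℂ) :
    P * lindbladian H K A = lindbladian H K (P * A) := by
  have e : ∀ j, P * (star (K j) * A * K j) = star (K j) * (P * A) * K j := fun j => by
    simp only [← mul_assoc, (hK' j).eq]
  have e2 : ∀ j, P * (star (K j) * K j * A) = star (K j) * K j * (P * A) := fun j => by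
    rw [← mul_assoc, ((hK' j).mul_right (hK j)).eq, mul_assoc]
  have e3 : P * (H * A) = H * (P * A) := by rw [← mul_assoc, hH.eq, mul_assoc]
  simp only [lindbladian, mul_add, mul_sub, Finset.mul_sum, mul_smul_comm, e, e2, e3]
  simp only [mul_assoc]

theorem lindbladian_mul {m : Type*} [Fintype m] {H : Matrix m m ℂ} {ℓ : ℕ}
    {K : Fin ℓ → Matrix m m ℂ} {P : Matrix m m ℂ} (hH : Commute P H)
    (hK : ∀ j, Commute P (K j)) (hK' : ∀ j, Commute P (star (K j))) (A : Matrix m m ℂ) :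
    lindbladian H K A * P = lindbladian H K (A * P) := by
  have e : ∀ j, star (K j) * A * K j * P = star (K j) * (A * P) * K j := fun j => by
    simp only [mul_assoc, (hK j).eq]
  have e2 : ∀ j, A * (star (K j) * K j) * P = A * P * (star (K j) * K j) := fun j => by
    rw [mul_assoc, ← ((hK' j).mul_right (hK j)).eq, mul_assoc]
  have e3 : A * H * P = A * P * H := by rw [mul_assoc, ← hH.eq, mul_assoc]
  simp only [lindbladian, add_mul, sub_mul, Finset.sum_mul, smul_mul_assoc, e, e2, e3]
  simp only [mul_assoc]

theorem extend_comm {Z Z' Λ : Finset Γ} (h : Z ⊆ Λ) (h' : Z' ⊆ Λ) (hd : Disjoint Z Z')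
    {Φ : Obs q Z →ₗ[ℂ] Obs q Z} (hΦ : IsLindblad Φ)
    {Ψ : Obs q Z' →ₗ[ℂ] Obs q Z'} (hΨ : IsLindblad Ψ) (A : Obs q Λ) :
    QSpin.extend q h Φ (QSpin.extend q h' Ψ A) = QSpin.extend q h' Ψ (QSpin.extend q h Φ A) := by
  obtain ⟨H, ℓ, K, -, hΦ⟩ := hΦ.exists_lindbladian
  obtain ⟨H', ℓ', K', -, hΨ⟩ := hΨ.exists_lindbladian
  -- `Ψ` is a bimodule map over the algebra of `Z`, while `Φ` is built from multiplications by
  -- elements of that algebra.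
  have c : ∀ (P : Obs q Z) (B : Obs q Λ), embed q h P * QSpin.extend q h' Ψ B =
      QSpin.extend q h' Ψ (embed q h P * B) := fun P B => by
    rw [extend_lindbladian h' hΨ, extend_lindbladian h' hΨ]
    refine mul_lindbladian (embed_commute h h' hd _ _) (fun _ => embed_commute h h' hd _ _)
      (fun j => ?_) _
    rw [← embedHom_apply h', ← map_star]
    exact embed_commute h h' hd _ _
  have c' : ∀ (P : Obs q Z) (B : Obs q Λ), QSpin.extend q h' Ψ B * embed q h P =
      QSpin.extend q h' Ψ (B * embed q h P) := fun P B => by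
    rw [extend_lindbladian h' hΨ, extend_lindbladian h' hΨ]
    refine lindbladian_mul (embed_commute h h' hd _ _) (fun _ => embed_commute h h' hd _ _)
      (fun j => ?_) _
    rw [← embedHom_apply h', ← map_star]
    exact embed_commute h h' hd _ _
  rw [extend_lindbladian h hΦ, extend_lindbladian h hΦ]
  simp only [lindbladian, ← embedHom_apply h, ← map_star, ← map_mul]
  simp only [embedHom_apply, c, c', map_add, map_sub, map_smul, map_sum]

/-! ### Norm bounds -/

theorem norm_reindex_le {m n : Type*} [Fintype m] [Fintype n] [DecidableEq m] [DecidableEq n]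
    (e : m ≃ n) (M : Matrix m m ℂ) : ‖Matrix.reindex e e M‖ ≤ ‖M‖ := by
  let φ : Matrix m m ℂ →⋆ₐ[ℂ] Matrix n n ℂ :=
    { (Matrix.reindexAlgEquiv ℂ ℂ e).toAlgHom with
      map_star' := fun A => by
        simp [Matrix.star_eq_conjTranspose] }
  exact NonUnitalStarAlgHom.norm_apply_le φ M

/-- Relabelling `κ` by `Fin (card κ)` is isometric and turns the ampliation into one of those in the
supremum. -/
theorem norm_ampliation_le {m κ : Type*} [Fintype m] [DecidableEq m] [Fintype κ] [DecidableEq κ]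
    {Φ : Matrix m m ℂ →ₗ[ℂ] Matrix m m ℂ} (hΦ : cbNorm Φ ≠ ∞) (M : Matrix (m × κ) (m × κ) ℂ) :
    ‖ampliation κ Φ M‖ ≤ (cbNorm Φ).toReal * ‖M‖ := by
  let e : m × κ ≃ m × Fin (Fintype.card κ) := (Equiv.refl m).prodCongr (Fintype.equivFin κ)
  have h1 : ampliation κ Φ M =
      Matrix.reindex e.symm e.symm (ampliation (Fin (Fintype.card κ)) Φ (Matrix.reindex e e M)) := by
    ext p s
    simp [ampliation, e]
  have h2 : ‖LinearMap.toContinuousLinearMap (ampliation (Fin (Fintype.card κ)) Φ)‖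
      ≤ (cbNorm Φ).toReal := by
    rw [← toReal_enorm]
    exact ENNReal.toReal_mono hΦ (le_iSup (fun k : ℕ =>
      ‖LinearMap.toContinuousLinearMap (ampliation (Fin k) Φ)‖ₑ) _)
  rw [h1]
  refine (norm_reindex_le _ _).trans ?_
  refine ((LinearMap.toContinuousLinearMap
    (ampliation (Fin (Fintype.card κ)) Φ)).le_opNorm (Matrix.reindex e e M)).trans ?_
  exact mul_le_mul h2 (norm_reindex_le _ _) (norm_nonneg _) ENNReal.toReal_nonneg

theorem norm_extend_le {Z Λ : Finset Γ} (h : Z ⊆ Λ) {Φ : Obs q Z →ₗ[ℂ] Obs q Z}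
    (hΦ : cbNorm Φ ≠ ∞) (M : Obs q Λ) :
    ‖QSpin.extend q h Φ M‖ ≤ (cbNorm Φ).toReal * ‖M‖ :=
  (norm_reindex_le _ _).trans ((norm_ampliation_le hΦ _).trans
    (mul_le_mul_of_nonneg_left (norm_reindex_le _ _) ENNReal.toReal_nonneg))

end LocalAlgebra

/-! ### Contraction semigroups -/

section Semigroup

variable {E : Type*} [NormedAddCommGroup E] [NormedSpace ℂ E] [CompleteSpace E]

theorem hasDerivAt_exp_smul (G : E →L[ℂ] E) (t : ℝ) :
    HasDerivAt (fun s : ℝ => NormedSpace.exp ((s : ℂ) • G))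
      (NormedSpace.exp ((t : ℂ) • G) * G) t := by
  have h := (hasDerivAt_exp_smul_const (𝕂 := ℂ) G (t : ℂ)).scomp t Complex.ofRealCLM.hasDerivAt
  simpa [Function.comp_def] using h

omit [CompleteSpace E] in
theorem commute_exp_smul {G D : E →L[ℂ] E} (h : Commute G D) (t : ℂ) :
    Commute (NormedSpace.exp (t • G)) D :=
  (h.smul_left t).exp_left

omit [CompleteSpace E] in
theorem exp_zero_smul_apply (G : E →L[ℂ] E) (A : E) :
    NormedSpace.exp (((0 : ℝ) : ℂ) • G) A = A := by simp

theorem hasDerivAt_exp_smul_apply (G : E →L[ℂ] E) (A : E) (t : ℝ) :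
    HasDerivAt (fun s : ℝ => NormedSpace.exp ((s : ℂ) • G) A)
      (G (NormedSpace.exp ((t : ℂ) • G) A)) t := by
  have h := hasDerivAt_exp_smul G t
  rw [(commute_exp_smul (Commute.refl G) (t : ℂ)).eq] at h
  have h' := (((ContinuousLinearMap.apply ℂ E A).restrictScalars ℝ).hasFDerivAt
    (x := NormedSpace.exp ((t : ℂ) • G))).comp_hasDerivAt t h
  exact h'

/-- A bounded dissipative operator generates a contraction semigroup. -/
theorem norm_exp_smul_apply_le {G : E →L[ℂ] E}
    (hG : ∀ (B : E) (h : ℝ), 0 ≤ h → ‖B‖ ≤ ‖B - (h : ℂ) • G B‖) {t : ℝ} (ht : 0 ≤ t) (A : E) :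
    ‖NormedSpace.exp ((t : ℂ) • G) A‖ ≤ ‖A‖ := by
  set u : ℝ → E := fun s => NormedSpace.exp ((s : ℂ) • G) A with hu
  have hd : ∀ s, HasDerivAt u (G (u s)) s := fun s => hasDerivAt_exp_smul_apply G A s
  have hv : ∀ s, HasDerivAt (fun s => u (t - s)) (-G (u (t - s))) s := fun s => by
    simpa using (hd (t - s)).comp_const_sub t s
  have hc : Continuous fun s => u (t - s) :=
    continuous_iff_continuousAt.2 fun s => (hv s).continuousAt
  -- Dissipativity controls a backward Euler step, so time is reversed: `-‖u (t - s)‖` must have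
  -- nonpositive right slope.
  have key := image_le_of_liminf_slope_right_le_deriv_boundary (f := fun s => -‖u (t - s)‖)
    (a := 0) (b := t) (B := fun _ => -‖u t‖) (B' := fun _ => 0) hc.norm.neg.continuousOn
    (by simp only [sub_zero, le_refl]) continuousOn_const (fun x _ => hasDerivWithinAt_const _ _ _) ?_
    (Set.right_mem_Icc.2 ht)
  · have : u 0 = A := exp_zero_smul_apply G A
    rw [sub_self, neg_le_neg_iff, this] at key
    exact key
  · intro x _ r hr
    refine Eventually.frequently ?_
    have ho := ((hasDerivAt_iff_isLittleO.1 (hv x)).def (half_pos hr)).filter_mono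
      (nhdsWithin_le_nhds (s := Set.Ioi x))
    filter_upwards [ho, self_mem_nhdsWithin] with z hz hxz
    have hxz : 0 < z - x := sub_pos.2 hxz
    rw [slope_def_field, div_lt_iff₀ hxz]
    rw [Real.norm_of_nonneg hxz.le] at hz
    -- `u - hGu` agrees with the solution at time `h` earlier up to `o(h)`.
    have h1 := hG (u (t - x)) (z - x) hxz.le
    rw [Complex.coe_smul] at h1
    have h2 : ‖u (t - x) - (z - x) • G (u (t - x))‖ - ‖u (t - z)‖ ≤
        ‖u (t - z) - u (t - x) - (z - x) • -G (u (t - x))‖ := by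
      refine (norm_sub_norm_le _ _).trans_eq ?_
      rw [← norm_neg]
      congr 1
      rw [smul_neg]
      abel
    nlinarith [mul_pos hr hxz]

end Semigroup

/-! ### Maps of Lindblad form are dissipative -/

section Dissipative

variable {m : Type*} [Fintype m] [DecidableEq m]

local notation "Op" => Matrix.toEuclideanCLM (n := m) (𝕜 := ℂ)

/-- `Re ⟨A ψ, Φ(A) ψ⟩ ≤ 0` whenever `A* A ψ = ‖A‖² ψ`. -/
def IsDissipative (Φ : Matrix m m ℂ → Matrix m m ℂ) : Prop :=
  ∀ (A : Matrix m m ℂ) (ψ : EuclideanSpace ℂ m),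
    (∀ φ, inner ℂ (Op A ψ) (Op A φ) = ((‖A‖ ^ 2 : ℝ) : ℂ) * inner ℂ ψ φ) →
      (inner ℂ (Op A ψ) (Op (Φ A) ψ)).re ≤ 0

theorem IsDissipative.sum {ι : Type*} (s : Finset ι) {Φ : ι → Matrix m m ℂ → Matrix m m ℂ}
    (h : ∀ i ∈ s, IsDissipative (Φ i)) : IsDissipative fun A => ∑ i ∈ s, Φ i A := by
  intro A ψ hψ
  simp only [map_sum, _root_.sum_apply, inner_sum, Complex.re_sum]
  exact Finset.sum_nonpos fun i hi => h i hi A ψ hψ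

/-- The Hamiltonian part is purely imaginary. For each `K`, Cauchy–Schwarz bounds the cross term by
`‖K A ψ‖ ‖A‖ ‖K ψ‖`, and the anticommutator subtracts half the sum of the squares of `‖K A ψ‖` and
`‖A‖ ‖K ψ‖`. -/
theorem isDissipative_lindbladian {H : Matrix m m ℂ} (hH : IsSelfAdjoint H) {ℓ : ℕ}
    (K : Fin ℓ → Matrix m m ℂ) : IsDissipative (lindbladian H K) := by
  intro A ψ hψ
  have hH' : ∀ x y, inner ℂ (Op H x) y = inner ℂ x (Op H y) := fun x y => by
    have : ContinuousLinearMap.adjoint (Op H) = Op H := by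
      rw [← ContinuousLinearMap.star_eq_adjoint, ← map_star, hH.star_eq]
    conv_rhs => rw [← this]
    rw [ContinuousLinearMap.adjoint_inner_right]
  have hK' : ∀ j x y, inner ℂ x (Op (star (K j)) y) = inner ℂ (Op (K j) x) y := fun j x y => by
    rw [map_star, ContinuousLinearMap.star_eq_adjoint, ContinuousLinearMap.adjoint_inner_right]
  have him : ∀ x, (inner ℂ x (Op H x)).im = 0 := fun x => by
    have := inner_conj_symm (𝕜 := ℂ) x (Op H x)
    rw [hH'] at this
    exact Complex.conj_eq_iff_im.1 this
  -- `hψ` removes `A` from both slots of the terms where `A` acts last, here with `φ = H ψ` and `φ =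
  -- K* K ψ`.
  have e : inner ℂ (Op A ψ) (Op (lindbladian H K A) ψ) =
      Complex.I * (inner ℂ (Op A ψ) (Op H (Op A ψ)) -
          ((‖A‖ ^ 2 : ℝ) : ℂ) * inner ℂ ψ (Op H ψ)) +
        ∑ j, (inner ℂ (Op (K j) (Op A ψ)) (Op A (Op (K j) ψ)) -
          (1 / 2 : ℂ) * (inner ℂ (Op (K j) (Op A ψ)) (Op (K j) (Op A ψ)) +
            ((‖A‖ ^ 2 : ℝ) : ℂ) * inner ℂ (Op (K j) ψ) (Op (K j) ψ))) := by
    simp only [lindbladian, map_add, map_sum, map_sub, map_smul, map_mul,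
      _root_.add_apply, _root_.sum_apply, _root_.sub_apply,
      _root_.smul_apply, mul_apply_eq_comp, inner_add_right, inner_sum,
      inner_sub_right, inner_smul_right, hK', hψ]
  have hre : ∀ j, (inner ℂ (Op (K j) (Op A ψ)) (Op A (Op (K j) ψ)) -
          (1 / 2 : ℂ) * (inner ℂ (Op (K j) (Op A ψ)) (Op (K j) (Op A ψ)) +
            ((‖A‖ ^ 2 : ℝ) : ℂ) * inner ℂ (Op (K j) ψ) (Op (K j) ψ))).re ≤ 0 := fun j => by
    have h1 : (inner ℂ (Op (K j) (Op A ψ)) (Op A (Op (K j) ψ))).re ≤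
        ‖Op (K j) (Op A ψ)‖ * (‖A‖ * ‖Op (K j) ψ‖) :=
      (re_inner_le_norm (𝕜 := ℂ) _ _).trans
        (mul_le_mul_of_nonneg_left ((Op A).le_opNorm _) (norm_nonneg _))
    rw [inner_self_eq_norm_sq_to_K, inner_self_eq_norm_sq_to_K]
    have e2 : (1 / 2 : ℂ) * ((‖Op (K j) (Op A ψ)‖ : ℂ) ^ 2 +
        ((‖A‖ ^ 2 : ℝ) : ℂ) * (‖Op (K j) ψ‖ : ℂ) ^ 2) =
        ((1 / 2 * (‖Op (K j) (Op A ψ)‖ ^ 2 + ‖A‖ ^ 2 * ‖Op (K j) ψ‖ ^ 2) : ℝ) : ℂ) := by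
      push_cast; ring
    have e3 : ∀ w : ℂ, (w - ((1 / 2 * (‖Op (K j) (Op A ψ)‖ ^ 2 + ‖A‖ ^ 2 * ‖Op (K j) ψ‖ ^ 2) : ℝ) : ℂ)).re =
        w.re - 1 / 2 * (‖Op (K j) (Op A ψ)‖ ^ 2 + ‖A‖ ^ 2 * ‖Op (K j) ψ‖ ^ 2) := fun w => by
      rw [Complex.sub_re, Complex.ofReal_re]
    erw [e2]
    rw [e3]
    nlinarith [sq_nonneg (‖Op (K j) (Op A ψ)‖ - ‖A‖ * ‖Op (K j) ψ‖)]
  rw [e, Complex.add_re, Complex.re_sum]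
  have h0 : (Complex.I * (inner ℂ (Op A ψ) (Op H (Op A ψ)) -
          ((‖A‖ ^ 2 : ℝ) : ℂ) * inner ℂ ψ (Op H ψ))).re = 0 := by
    rw [Complex.I_mul_re, Complex.sub_im, him, Complex.im_ofReal_mul, him]
    simp
  rw [h0, zero_add]
  exact Finset.sum_nonpos fun j _ => hre j

/-- In finite dimension the norm is attained on the unit sphere, and a maximizer is an eigenvector
of `A* A` with eigenvalue `‖A‖²`. -/
theorem exists_norming_vector [Nonempty m] (A : Matrix m m ℂ) :
    ∃ ψ : EuclideanSpace ℂ m, ‖ψ‖ = 1 ∧ ‖Op A ψ‖ = ‖A‖ ∧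
      ∀ φ, inner ℂ (Op A ψ) (Op A φ) = ((‖A‖ ^ 2 : ℝ) : ℂ) * inner ℂ ψ φ := by
  obtain ⟨ψ, hψ, hmax⟩ := (isCompact_sphere (0 : EuclideanSpace ℂ m) 1).exists_isMaxOn
    (NormedSpace.sphere_nonempty.2 zero_le_one) (Op A).continuous.norm.continuousOn
  have h1 : ‖ψ‖ = 1 := by simpa using hψ
  have hA : ‖Op A‖ = ‖A‖ := rfl
  have h2 : ‖Op A ψ‖ = ‖A‖ := by
    refine le_antisymm (by simpa [h1, hA] using (Op A).le_opNorm ψ) ?_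
    rw [← hA]
    exact (Op A).opNorm_le_of_unit_norm (norm_nonneg _) fun x hx => hmax (by simpa using hx)
  refine ⟨ψ, h1, h2, fun φ => ?_⟩
  set a := Op A
  set ψ' := ContinuousLinearMap.adjoint a (a ψ) with hψ'
  have h3 : ‖ψ'‖ ≤ ‖A‖ ^ 2 := by
    refine ((ContinuousLinearMap.adjoint a).le_opNorm _).trans ?_
    rw [LinearIsometryEquiv.norm_map, h2, hA, sq]
  have h4 : inner ℂ ψ' ψ = ((‖A‖ ^ 2 : ℝ) : ℂ) := by
    rw [hψ', ContinuousLinearMap.adjoint_inner_left, inner_self_eq_norm_sq_to_K, h2]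
    push_cast; rfl
  have h5 : ψ' = ((‖A‖ ^ 2 : ℝ) : ℂ) • ψ := by
    -- Expanding the square gives `‖ψ'‖² - ‖A‖⁴`, which is nonpositive by `h3`.
    rw [← sub_eq_zero, ← norm_eq_zero, ← sq_eq_zero_iff]
    refine le_antisymm ?_ (sq_nonneg _)
    rw [norm_sub_sq (𝕜 := ℂ), inner_smul_right, h4, norm_smul, h1, mul_one, Complex.norm_real,
      Real.norm_of_nonneg (sq_nonneg _), ← Complex.ofReal_mul]
    have e : RCLike.re ((‖A‖ ^ 2 * ‖A‖ ^ 2 : ℝ) : ℂ) = ‖A‖ ^ 2 * ‖A‖ ^ 2 := Complex.ofReal_re _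
    rw [e]
    nlinarith [norm_nonneg ψ']
  rw [← ContinuousLinearMap.adjoint_inner_left, ← hψ', h5, inner_smul_left, Complex.conj_ofReal]

/-- Pairing `(A - hΦ(A))ψ` with `Aψ` at a norming vector gives `‖A‖² ≤ ‖A‖ ‖A - hΦ(A)‖`. -/
theorem IsDissipative.norm_le {Φ : Matrix m m ℂ → Matrix m m ℂ} (hΦ : IsDissipative Φ)
    (A : Matrix m m ℂ) {h : ℝ} (hh : 0 ≤ h) : ‖A‖ ≤ ‖A - (h : ℂ) • Φ A‖ := by
  cases isEmpty_or_nonempty m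
  · simp [Subsingleton.elim A 0]
  obtain ⟨ψ, h1, h2, h3⟩ := exists_norming_vector A
  have h4 := hΦ A ψ h3
  have h5 : (inner ℂ (Op A ψ) (Op (A - (h : ℂ) • Φ A) ψ)).re =
      ‖A‖ ^ 2 - h * (inner ℂ (Op A ψ) (Op (Φ A) ψ)).re := by
    simp only [map_sub, map_smul, _root_.sub_apply, _root_.smul_apply,
      inner_sub_right, inner_smul_right, Complex.sub_re, Complex.re_ofReal_mul]
    rw [inner_self_eq_norm_sq_to_K, h2]
    norm_cast
  have h6 : (inner ℂ (Op A ψ) (Op (A - (h : ℂ) • Φ A) ψ)).re ≤ ‖A‖ * ‖A - (h : ℂ) • Φ A‖ := by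
    refine (re_inner_le_norm (𝕜 := ℂ) _ _).trans ?_
    rw [h2]
    refine mul_le_mul_of_nonneg_left ?_ (norm_nonneg _)
    refine ((Op (A - (h : ℂ) • Φ A)).le_opNorm ψ).trans_eq ?_
    rw [h1, mul_one]
    rfl
  rcases (norm_nonneg A).eq_or_lt with h0 | h0
  · rw [← h0]; exact norm_nonneg _
  · nlinarith

theorem IsLindblad.isDissipative {Φ : Matrix m m ℂ →ₗ[ℂ] Matrix m m ℂ} (h : IsLindblad Φ) :
    IsDissipative Φ := by
  obtain ⟨H, ℓ, K, hH, hΦ⟩ := h.exists_lindbladian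
  rw [funext hΦ]
  exact isDissipative_lindbladian hH K

end Dissipative

/-! ### Duhamel estimate -/

section Duhamel

variable {E : Type*} [NormedAddCommGroup E] [NormedSpace ℂ E] [CompleteSpace E]

/-- A solution of `u' = G u + f`, where `G` generates a contraction semigroup, grows at most at the
rate `‖f‖`. -/
theorem norm_le_of_hasDerivAt_inhomogeneous {G : E →L[ℂ] E}
    (hG : ∀ t : ℝ, 0 ≤ t → ∀ B : E, ‖NormedSpace.exp ((t : ℂ) • G) B‖ ≤ ‖B‖)
    {u f : ℝ → E} {b b' : ℝ → ℝ} (hu : ∀ s, HasDerivAt u (G (u s) + f s) s)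
    (hb : ∀ s, HasDerivAt b (b' s) s) (h0 : ‖u 0‖ ≤ b 0) (hf : ∀ s, 0 ≤ s → ‖f s‖ ≤ b' s)
    {t : ℝ} (ht : 0 ≤ t) : ‖u t‖ ≤ b t := by
  -- Variation of constants: the terms with `G` cancel in the derivative of `c s (u s)`, leaving `c
  -- s (f s)`.
  set c : ℝ → E →L[ℂ] E := fun s => NormedSpace.exp (((t - s : ℝ) : ℂ) • G) with hc
  have hc' : ∀ s, HasDerivAt c (-(c s * G)) s := fun s => by
    exact ((hasDerivAt_exp_smul G (t - s)).scomp s ((hasDerivAt_id s).const_sub t)).congr_deriv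
      (by simp [hc])
  have hcr : ∀ s, HasDerivAt (fun s => (c s).restrictScalars ℝ)
      ((-(c s * G)).restrictScalars ℝ) s := fun s =>
    (ContinuousLinearMap.restrictScalarsL ℂ E E ℝ ℝ).hasFDerivAt.comp_hasDerivAt s (hc' s)
  have hw : ∀ s, HasDerivAt (fun s => c s (u s)) (c s (f s)) s := fun s => by
    have := (hcr s).clm_apply (hu s)
    simpa using this
  have key := image_norm_le_of_norm_deriv_right_le_deriv_boundary (f := fun s => c s (u s))
    (a := 0) (b := t) (B := b) (B' := b')
    (continuous_iff_continuousAt.2 fun s => (hw s).continuousAt).continuousOn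
    (fun s _ => (hw s).hasDerivWithinAt)
    ((hG _ (by simpa using ht) _).trans h0) hb
    (fun s hs => (hG _ (by simpa using hs.2.le) _).trans (hf s hs.1)) (Set.right_mem_Icc.2 ht)
  simpa [hc] using key

end Duhamel

/-! ### Lieb–Robinson bounds -/

section LiebRobinson

variable {Γ : Type*} [DecidableEq Γ]

/-- The weight `∑_{x ∈ X} (1_{x ∈ Z} + κ ∑_{z ∈ Z} f(x, z))`. -/
def lrWeight (f : Γ → Γ → ℝ) (X : Finset Γ) (κ : ℝ) (Z : Finset Γ) : ℝ :=
  ∑ x ∈ X, ((if x ∈ Z then 1 else 0) + κ * ∑ z ∈ Z, f x z)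

theorem lrWeight_nonneg {f : Γ → Γ → ℝ} (hf : ∀ x y, 0 ≤ f x y) (X : Finset Γ) {κ : ℝ}
    (hκ : 0 ≤ κ) (Z : Finset Γ) : 0 ≤ lrWeight f X κ Z :=
  Finset.sum_nonneg fun _ _ => add_nonneg (by split_ifs <;> norm_num)
    (mul_nonneg hκ (Finset.sum_nonneg fun _ _ => hf _ _))

/-- A union bound over the points of `Y` that `Z` hits. The indicator then contributes `M f(x,y)`,
and the `κ` part contributes `κ M ∑_z f(x,z) f(z,y) ≤ κ M C f(x,y)`. -/
theorem sum_lrWeight_le {f : Γ → Γ → ℝ} (hf : ∀ x y, 0 ≤ f x y) {Λ : Finset Γ}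
    {a : Finset Γ → ℝ} (ha : ∀ Z, 0 ≤ a Z) {M C : ℝ} (hM : 0 ≤ M)
    (hconv : ∀ x y, ∑ z ∈ Λ, f x z * f z y ≤ C * f x y)
    (hsum : ∀ x y, ∑ Z ∈ Λ.powerset with x ∈ Z ∧ y ∈ Z, a Z ≤ M * f x y)
    (X Y : Finset Γ) {κ : ℝ} (hκ : 0 ≤ κ) :
    ∑ Z ∈ Λ.powerset with ¬Disjoint Z Y, a Z * lrWeight f X κ Z ≤
      M * (1 + κ * C) * ∑ x ∈ X, ∑ y ∈ Y, f x y := by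
  have h1 : ∑ Z ∈ Λ.powerset with ¬Disjoint Z Y, a Z * lrWeight f X κ Z ≤
      ∑ y ∈ Y, ∑ Z ∈ Λ.powerset with y ∈ Z, a Z * lrWeight f X κ Z := by
    simp only [Finset.sum_filter]
    rw [Finset.sum_comm]
    refine Finset.sum_le_sum fun Z _ => ?_
    have hn : ∀ y ∈ Y, 0 ≤ (if y ∈ Z then a Z * lrWeight f X κ Z else 0) := fun y _ => by
      split_ifs
      exacts [mul_nonneg (ha Z) (lrWeight_nonneg hf X hκ Z), le_rfl]
    by_cases h : Disjoint Z Y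
    · rw [if_neg (not_not.2 h)]
      exact Finset.sum_nonneg hn
    · rw [if_pos h]
      obtain ⟨y, hyZ, hyY⟩ := Finset.not_disjoint_iff.1 h
      exact (if_pos hyZ).symm.le.trans (Finset.single_le_sum hn hyY)
  have h2 : ∀ x y, ∑ Z ∈ Λ.powerset with y ∈ Z,
      a Z * ((if x ∈ Z then 1 else 0) + κ * ∑ z ∈ Z, f x z) ≤ M * (1 + κ * C) * f x y := by
    intro x y
    have e1 : ∑ Z ∈ Λ.powerset with y ∈ Z, a Z * (if x ∈ Z then 1 else 0) =
        ∑ Z ∈ Λ.powerset with x ∈ Z ∧ y ∈ Z, a Z := by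
      simp only [Finset.sum_filter, mul_ite, mul_one, mul_zero, ite_and]
      refine Finset.sum_congr rfl fun Z _ => ?_
      split_ifs <;> rfl
    have e2 : ∑ Z ∈ Λ.powerset with y ∈ Z, a Z * (κ * ∑ z ∈ Z, f x z) =
        κ * ∑ z ∈ Λ, f x z * ∑ Z ∈ Λ.powerset with z ∈ Z ∧ y ∈ Z, a Z := by
      simp only [Finset.sum_filter, Finset.mul_sum]
      rw [Finset.sum_comm]
      refine Finset.sum_congr rfl fun Z hZ => ?_
      have hs : ∑ z ∈ Λ with z ∈ Z, f x z = ∑ z ∈ Z, f x z := by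
        rw [Finset.filter_mem_eq_inter, Finset.inter_eq_right.2 (Finset.mem_powerset.1 hZ)]
      by_cases hy : y ∈ Z
      · simp only [hy, and_true, if_true]
        rw [← Finset.mul_sum, ← Finset.mul_sum, ← hs, Finset.sum_filter, Finset.mul_sum,
          Finset.mul_sum]
        refine Finset.sum_congr rfl fun z _ => ?_
        split_ifs <;> ring
      · simp [hy]
    simp only [mul_add, Finset.sum_add_distrib]
    rw [e1, e2]
    have h3 : ∑ z ∈ Λ, f x z * ∑ Z ∈ Λ.powerset with z ∈ Z ∧ y ∈ Z, a Z ≤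
        M * (C * f x y) := by
      refine le_trans ?_ (mul_le_mul_of_nonneg_left (hconv x y) hM)
      rw [Finset.mul_sum]
      refine Finset.sum_le_sum fun z _ => ?_
      exact (mul_le_mul_of_nonneg_left (hsum z y) (hf x z)).trans_eq (by ring)
    have := mul_le_mul_of_nonneg_left h3 hκ
    linarith [hsum x y]
  refine h1.trans ?_
  simp only [lrWeight, Finset.mul_sum]
  rw [Finset.sum_comm (s := X)]
  refine Finset.sum_le_sum fun y _ => ?_
  rw [Finset.sum_comm]
  refine Finset.sum_le_sum fun x _ => ?_
  simpa only [Finset.mul_sum] using h2 x y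

/-- The equation `κ' = M(1 + κC)` with `κ(0) = 0`: the Lieb–Robinson weight reproduces itself under
the Duhamel iteration. -/
theorem hasDerivAt_exp_sub_one_div (M : ℝ) {C : ℝ} (hC : 0 < C) (s : ℝ) :
    HasDerivAt (fun s => (Real.exp (M * C * s) - 1) / C)
      (M * (1 + (Real.exp (M * C * s) - 1) / C * C)) s := by
  have h := ((((hasDerivAt_id s).const_mul (M * C)).exp).sub_const 1).div_const C
  refine h.congr_deriv ?_
  simp only [id]
  field_simp
  ring

variable {E : Type*} [NormedAddCommGroup E] [NormedSpace ℂ E] [CompleteSpace E]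
  {f : Γ → Γ → ℝ} {Λ X : Finset Γ} {a : Finset Γ → ℝ} {M C : ℝ} {D : Finset Γ → E →L[ℂ] E} {A : E}

/-- Lieb–Robinson bound for the action of a local term on the evolution of a local observable, in
terms of the commutation and locality properties of the local terms `D Z`. -/
theorem norm_local_term_evolution_le (hf : ∀ x y, 0 ≤ f x y) (ha : ∀ Z, 0 ≤ a Z) (hM : 0 ≤ M)
    (hC : 0 < C) (hconv : ∀ x y, ∑ z ∈ Λ, f x z * f z y ≤ C * f x y)
    (hsum : ∀ x y, ∑ Z ∈ Λ.powerset with x ∈ Z ∧ y ∈ Z, a Z ≤ M * f x y)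
    (hD : ∀ Z, Z ⊆ Λ → Z.Nonempty → ∀ B, ‖D Z B‖ ≤ a Z * ‖B‖)
    (hcontr : ∀ S ⊆ Λ.powerset, ∀ t : ℝ, 0 ≤ t → ∀ B,
      ‖NormedSpace.exp ((t : ℂ) • ∑ Z ∈ S, D Z) B‖ ≤ ‖B‖)
    (hcomm : ∀ Z Z', Disjoint Z Z' → Commute (D Z) (D Z'))
    (hA : ∀ Z, Disjoint Z X → D Z A = 0)
    {Z : Finset Γ} (hZ : Z ⊆ Λ) (hZ0 : Z.Nonempty) {t : ℝ} (ht : 0 ≤ t) :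
    ‖D Z (NormedSpace.exp ((t : ℂ) • ∑ Z ∈ Λ.powerset, D Z) A)‖ ≤
      ‖A‖ * (a Z * lrWeight f X ((Real.exp (M * C * t) - 1) / C) Z) := by
  set G := ∑ Z ∈ Λ.powerset, D Z with hG
  set T : ℝ → E := fun t => NormedSpace.exp ((t : ℂ) • G) A with hT
  set κ : ℝ → ℝ := fun s => (Real.exp (M * C * s) - 1) / C with hκ
  have hκ0 : ∀ s, 0 ≤ s → 0 ≤ κ s := fun s hs =>
    div_nonneg (sub_nonneg.2 (Real.one_le_exp (by positivity))) hC.le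
  set S := ∑ Z ∈ Λ.powerset, a Z with hS
  have haS : ∀ Z, Z ⊆ Λ → a Z ≤ S := fun Z hZ =>
    Finset.single_le_sum (fun Z _ => ha Z) (Finset.mem_powerset.2 hZ)
  have hS0 : 0 ≤ S := Finset.sum_nonneg fun Z _ => ha Z
  set N : ℝ := (Λ.powerset.card : ℝ) with hN
  have hN0 : 0 ≤ N := Nat.cast_nonneg _
  have hTd : ∀ s, HasDerivAt T (G (T s)) s := hasDerivAt_exp_smul_apply G A
  -- The target plus an error. The case `n = 0` is the crude bound `S ‖A‖`; each Duhamel step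
  -- integrates the error once, at the cost of `S` for the outer term and at most `N` neighbours.
  have main : ∀ n : ℕ, ∀ Z, Z ⊆ Λ → Z.Nonempty → ∀ s : ℝ, 0 ≤ s → ‖D Z (T s)‖ ≤
      ‖A‖ * (a Z * lrWeight f X (κ s) Z) + S * ‖A‖ * ((S * N * s) ^ n / n.factorial) := by
    intro n
    induction n with
    | zero =>
      intro Z hZ hZ0 s hs
      have h1 : ‖D Z (T s)‖ ≤ S * ‖A‖ := (hD Z hZ hZ0 _).trans
        (mul_le_mul (haS Z hZ) (hcontr _ subset_rfl s hs A) (norm_nonneg _) hS0)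
      have h2 := mul_nonneg (norm_nonneg A)
        (mul_nonneg (ha Z) (lrWeight_nonneg hf X (hκ0 s hs) Z))
      simpa using h1.trans (le_add_of_nonneg_left h2)
    | succ n ih =>
      intro Z hZ hZ0 s hs
      -- Terms disjoint from `Z` move past `D Z` and become the homogeneous part; only the others
      -- count as forcing.
      have hsplit : ∀ s, D Z (G (T s)) = (∑ Z' ∈ Λ.powerset with Disjoint Z' Z, D Z') (D Z (T s)) +
          D Z (∑ Z' ∈ Λ.powerset with ¬Disjoint Z' Z, D Z' (T s)) := fun s => by
        rw [hG, ← Finset.sum_filter_add_sum_filter_not Λ.powerset (fun Z' => Disjoint Z' Z),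
          _root_.add_apply, map_add, _root_.sum_apply, _root_.sum_apply, _root_.sum_apply, map_sum]
        congr 1
        refine Finset.sum_congr rfl fun Z' hZ' => ?_
        exact DFunLike.congr_fun (hcomm Z Z' (Finset.mem_filter.1 hZ').2.symm).eq (T s)
      refine norm_le_of_hasDerivAt_inhomogeneous (u := fun s => D Z (T s))
        (G := ∑ Z' ∈ Λ.powerset with Disjoint Z' Z, D Z')
        (f := fun s => D Z (∑ Z' ∈ Λ.powerset with ¬Disjoint Z' Z, D Z' (T s)))
        (b := fun s => ‖A‖ * (a Z * lrWeight f X (κ s) Z) +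
          S * ‖A‖ * ((S * N * s) ^ (n + 1) / (n + 1).factorial))
        (b' := fun s => ‖A‖ * (a Z * ∑ x ∈ X, M * (1 + κ s * C) * ∑ z ∈ Z, f x z) +
          S * ‖A‖ * (S * N * ((S * N * s) ^ n / n.factorial)))
        (hcontr _ (Finset.filter_subset _ _)) (fun s => ?_) (fun s => ?_) ?_ (fun s hs => ?_) hs
      · rw [← hsplit]
        exact ((D Z).restrictScalars ℝ).hasFDerivAt.comp_hasDerivAt s (hTd s)
      · refine HasDerivAt.add ?_ ?_
        · refine HasDerivAt.const_mul _ (HasDerivAt.const_mul _ ?_)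
          refine HasDerivAt.fun_sum fun x _ => ?_
          exact ((hasDerivAt_exp_sub_one_div M hC s).mul_const _).const_add _
        · refine HasDerivAt.const_mul _ ?_
          have h := (((hasDerivAt_id s).const_mul (S * N)).pow (n + 1)).div_const
            ((n + 1).factorial : ℝ)
          refine h.congr_deriv ?_
          have : (n.factorial : ℝ) ≠ 0 := by positivity
          simp only [id, Nat.factorial_succ]
          push_cast
          field_simp
      · have hκz : κ 0 = 0 := by simp [hκ]
        have hT0 : T 0 = A := by simp [hT]
        simp only [hκz, hT0, mul_zero, ne_eq, Nat.add_eq_zero_iff, one_ne_zero, and_false,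
          not_false_eq_true, zero_pow, zero_div, add_zero]
        -- At time zero `κ` vanishes, and the indicator in the weight pays for the sets meeting `X`.
        by_cases hd : Disjoint Z X
        · rw [hA Z hd, norm_zero]
          exact mul_nonneg (norm_nonneg A) (mul_nonneg (ha Z) (lrWeight_nonneg hf X le_rfl Z))
        · obtain ⟨x, hxZ, hxX⟩ := Finset.not_disjoint_iff.1 hd
          have h1 : 1 ≤ lrWeight f X 0 Z := by
            simp only [lrWeight, zero_mul, add_zero]
            refine (by rw [if_pos hxZ] : (1 : ℝ) = if x ∈ Z then 1 else 0).le.trans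
              (Finset.single_le_sum (f := fun x => if x ∈ Z then (1 : ℝ) else 0)
                (fun y _ => ?_) hxX)
            split_ifs <;> norm_num
          calc ‖D Z A‖ ≤ a Z * ‖A‖ := hD Z hZ hZ0 A
            _ = ‖A‖ * (a Z * 1) := by ring
            _ ≤ _ := by gcongr; exact ha Z
      · set ρ := S * ‖A‖ * ((S * N * s) ^ n / n.factorial) with hρ
        have hρ0 : 0 ≤ ρ := by positivity
        have h1 : ‖∑ Z' ∈ Λ.powerset with ¬Disjoint Z' Z, D Z' (T s)‖ ≤
            ‖A‖ * (M * (1 + κ s * C) * ∑ x ∈ X, ∑ y ∈ Z, f x y) + N * ρ := by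
          refine (norm_sum_le _ _).trans ?_
          have h2 : ∀ Z' ∈ Λ.powerset.filter (fun Z' => ¬Disjoint Z' Z), ‖D Z' (T s)‖ ≤
              ‖A‖ * (a Z' * lrWeight f X (κ s) Z') + ρ := fun Z' hZ' => by
            obtain ⟨h3, h4⟩ := Finset.mem_filter.1 hZ'
            obtain ⟨x, hx, -⟩ := Finset.not_disjoint_iff.1 h4
            exact ih Z' (Finset.mem_powerset.1 h3) ⟨x, hx⟩ s hs
          refine (Finset.sum_le_sum h2).trans ?_
          rw [Finset.sum_add_distrib, ← Finset.mul_sum, Finset.sum_const, nsmul_eq_mul]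
          refine add_le_add (mul_le_mul_of_nonneg_left
            (sum_lrWeight_le hf ha hM hconv hsum X Z (hκ0 s hs)) (norm_nonneg _)) ?_
          exact mul_le_mul_of_nonneg_right
            (Nat.cast_le.2 (Finset.card_le_card (Finset.filter_subset _ _))) hρ0
        refine (hD Z hZ hZ0 _).trans ((mul_le_mul_of_nonneg_left h1 (ha Z)).trans ?_)
        rw [mul_add, ← Finset.mul_sum]
        refine add_le_add (by ring_nf; rfl) ?_
        calc a Z * (N * ρ) ≤ S * (N * ρ) := mul_le_mul_of_nonneg_right (haS Z hZ) (by positivity)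
          _ = _ := by rw [hρ]; ring
  have hlim : Tendsto (fun n : ℕ => ‖A‖ * (a Z * lrWeight f X (κ t) Z) +
      S * ‖A‖ * ((S * N * t) ^ n / n.factorial)) atTop
      (𝓝 (‖A‖ * (a Z * lrWeight f X (κ t) Z) + S * ‖A‖ * 0)) :=
    ((FloorSemiring.tendsto_pow_div_factorial_atTop (S * N * t)).const_mul _).const_add _
  rw [mul_zero, add_zero] at hlim
  exact ge_of_tendsto' hlim fun n => main n Z hZ hZ0 t ht

/-- Dependence of the dynamics on the volume, in terms of the commutation and locality properties
of the local terms `D Z`. -/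
theorem norm_evolution_sub_evolution_le (hf : ∀ x y, 0 ≤ f x y) (ha : ∀ Z, 0 ≤ a Z) (hM : 0 ≤ M)
    (hC : 0 < C) (hconv : ∀ x y, ∑ z ∈ Λ, f x z * f z y ≤ C * f x y)
    (hsum : ∀ x y, ∑ Z ∈ Λ.powerset with x ∈ Z ∧ y ∈ Z, a Z ≤ M * f x y)
    (hD : ∀ Z, Z ⊆ Λ → Z.Nonempty → ∀ B, ‖D Z B‖ ≤ a Z * ‖B‖)
    (hcontr : ∀ S ⊆ Λ.powerset, ∀ t : ℝ, 0 ≤ t → ∀ B,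
      ‖NormedSpace.exp ((t : ℂ) • ∑ Z ∈ S, D Z) B‖ ≤ ‖B‖)
    (hcomm : ∀ Z Z', Disjoint Z Z' → Commute (D Z) (D Z'))
    (hA : ∀ Z, Disjoint Z X → D Z A = 0)
    {Y : Finset Γ} (hY : Y ⊆ Λ) {t : ℝ} (ht : 0 ≤ t) :
    ‖NormedSpace.exp ((t : ℂ) • ∑ Z ∈ Λ.powerset, D Z) A -
        NormedSpace.exp ((t : ℂ) • ∑ Z ∈ Y.powerset, D Z) A‖ ≤
      ‖A‖ * (((Real.exp (M * C * t) - 1) / C) * ∑ x ∈ X, ∑ y ∈ Λ \ Y, f x y) := by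
  have hYP : Y.powerset ⊆ Λ.powerset := Finset.powerset_mono.2 hY
  set G := ∑ Z ∈ Λ.powerset, D Z with hG
  set G' := ∑ Z ∈ Y.powerset, D Z with hG'
  have hGG : ∀ B, G B = G' B + ∑ Z ∈ Λ.powerset \ Y.powerset, D Z B := fun B => by
    rw [hG, ← Finset.sum_sdiff hYP, add_comm, _root_.add_apply, ← hG', _root_.sum_apply (Λ.powerset \ Y.powerset)]
  refine norm_le_of_hasDerivAt_inhomogeneous (G := G')
    (u := fun s : ℝ => NormedSpace.exp ((s : ℂ) • G) A - NormedSpace.exp ((s : ℂ) • G') A)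
    (f := fun s : ℝ => ∑ Z ∈ Λ.powerset \ Y.powerset, D Z (NormedSpace.exp ((s : ℂ) • G) A))
    (b := fun s => ‖A‖ * (((Real.exp (M * C * s) - 1) / C) * ∑ x ∈ X, ∑ y ∈ Λ \ Y, f x y))
    (b' := fun s => ‖A‖ * (M * (1 + (Real.exp (M * C * s) - 1) / C * C) *
      ∑ x ∈ X, ∑ y ∈ Λ \ Y, f x y))
    (hcontr _ hYP) (fun s => ?_) (fun s => ?_) ?_ (fun s hs => ?_) ht
  · refine ((hasDerivAt_exp_smul_apply G A s).sub
      (hasDerivAt_exp_smul_apply G' A s)).congr_deriv ?_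
    rw [hGG, map_sub]
    abel
  · exact ((hasDerivAt_exp_sub_one_div M hC s).mul_const _).const_mul _
  · simp
  · have hκ0 : 0 ≤ (Real.exp (M * C * s) - 1) / C :=
      div_nonneg (sub_nonneg.2 (Real.one_le_exp (by positivity))) hC.le
    -- A set not contained in `Y` meets `Λ \ Y`; in particular it is nonempty, as the bounds on
    -- local terms require.
    have hsub : Λ.powerset \ Y.powerset ⊆ Λ.powerset.filter fun Z => ¬Disjoint Z (Λ \ Y) := by
      intro Z hZ
      obtain ⟨h1, h2⟩ := Finset.mem_sdiff.1 hZ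
      refine Finset.mem_filter.2 ⟨h1, fun hd => h2 (Finset.mem_powerset.2 fun x hx => ?_)⟩
      by_contra hxY
      exact Finset.disjoint_left.1 hd hx (Finset.mem_sdiff.2 ⟨Finset.mem_powerset.1 h1 hx, hxY⟩)
    refine (norm_sum_le _ _).trans ((Finset.sum_le_sum_of_subset_of_nonneg hsub
      fun _ _ _ => norm_nonneg _).trans ?_)
    refine le_trans ?_ (mul_le_mul_of_nonneg_left
      (sum_lrWeight_le hf ha hM hconv hsum X (Λ \ Y) hκ0) (norm_nonneg _))
    rw [Finset.mul_sum]
    refine Finset.sum_le_sum fun Z hZ => ?_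
    obtain ⟨h3, h4⟩ := Finset.mem_filter.1 hZ
    obtain ⟨x, hx, -⟩ := Finset.not_disjoint_iff.1 h4
    exact norm_local_term_evolution_le hf ha hM hC hconv hsum hD hcontr hcomm hA
      (Finset.mem_powerset.1 h3) ⟨x, hx⟩ hs

end LiebRobinson

/-! ### Decay functions and interaction norms -/

section Decay

variable {Γ : Type*} [MetricSpace Γ] {F : ℝ → ℝ}

theorem IsConvBound.sum_le (hF : ∀ r, 0 ≤ r → 0 < F r) {C : ℝ} (hC : IsConvBound Γ F C)
    (Λ : Finset Γ) (x y : Γ) :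
    ∑ z ∈ Λ, F (dist x z) * F (dist z y) ≤ C * F (dist x y) := by
  have h := (ENNReal.sum_le_tsum Λ).trans (hC.2 x y)
  rw [← ENNReal.ofReal_sum_of_nonneg fun z _ =>
    mul_nonneg (hF _ dist_nonneg).le (hF _ dist_nonneg).le] at h
  exact (ENNReal.ofReal_le_ofReal_iff (mul_nonneg hC.1.le (hF _ dist_nonneg).le)).1 h

theorem IsDecayFunction.sum_le (hF : IsDecayFunction Γ F) (Λ : Finset Γ) (x y : Γ) :
    ∑ z ∈ Λ, F (dist x z) * F (dist z y) ≤ convConst Γ F * F (dist x y) := by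
  rw [← div_le_iff₀ (hF.pos _ dist_nonneg)]
  refine le_csInf hF.conv fun C hC => ?_
  rw [div_le_iff₀ (hF.pos _ dist_nonneg)]
  exact IsConvBound.sum_le hF.pos hC Λ x y

/-- The single summand `z = x = y` forces `F(0) ≤ C`. -/
theorem IsDecayFunction.convConst_pos [Nonempty Γ] (hF : IsDecayFunction Γ F) :
    0 < convConst Γ F := by
  obtain ⟨x⟩ := ‹Nonempty Γ›
  have h := hF.sum_le {x} x x
  have h0 := hF.pos 0 le_rfl
  simp only [Finset.sum_singleton, dist_self] at h
  exact h0.trans_le (le_of_mul_le_mul_right h h0)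

variable [DecidableEq Γ] {q : Γ → ℕ}

theorem tsum_cbNorm_le (hF : IsDecayFunction Γ F) (L : Interaction q) (x y : Γ) :
    ∑' Z : {Z : Finset Γ // x ∈ Z ∧ y ∈ Z}, cbNorm (L.term Z.1) ≤
      interactionNorm F L * ENNReal.ofReal (F (dist x y)) := by
  have h0 : ENNReal.ofReal (F (dist x y)) ≠ 0 :=
    (ENNReal.ofReal_pos.2 (hF.pos _ dist_nonneg)).ne'
  rw [← ENNReal.div_le_iff h0 ENNReal.ofReal_ne_top]
  refine le_sInf fun M hM => ?_
  rw [ENNReal.div_le_iff h0 ENNReal.ofReal_ne_top]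
  exact hM x y

/-- The interaction norm only sees sets containing a point, so it says nothing about the term of the
empty set. -/
theorem cbNorm_ne_top (hF : IsDecayFunction Γ F) {L : Interaction q}
    (hL : interactionNorm F L < ⊤) {Z : Finset Γ} (hZ : Z.Nonempty) : cbNorm (L.term Z) ≠ ⊤ := by
  obtain ⟨x, hx⟩ := hZ
  refine ne_top_of_le_ne_top (ENNReal.mul_ne_top hL.ne ENNReal.ofReal_ne_top)
    (le_trans ?_ (tsum_cbNorm_le hF L x x))
  exact ENNReal.le_tsum (f := fun Z : {Z : Finset Γ // x ∈ Z ∧ x ∈ Z} => cbNorm (L.term Z.1))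
    ⟨Z, hx, hx⟩

theorem sum_cbNorm_le (hF : IsDecayFunction Γ F) {L : Interaction q}
    (hL : interactionNorm F L < ⊤) (Λ : Finset Γ) (x y : Γ) :
    ∑ Z ∈ Λ.powerset with x ∈ Z ∧ y ∈ Z, (cbNorm (L.term Z)).toReal ≤
      (interactionNorm F L).toReal * F (dist x y) := by
  rw [← ENNReal.toReal_sum fun Z hZ =>
    cbNorm_ne_top hF hL ⟨x, (Finset.mem_filter.1 hZ).2.1⟩, ← Finset.sum_subtype_eq_sum_filter]
  refine (ENNReal.toReal_mono (ENNReal.mul_ne_top hL.ne ENNReal.ofReal_ne_top)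
    ((ENNReal.sum_le_tsum _).trans (tsum_cbNorm_le hF L x y))).trans_eq ?_
  rw [ENNReal.toReal_mul, ENNReal.toReal_ofReal (hF.pos _ dist_nonneg).le]

end Decay

/-! ### Local terms of the generator -/

section LocalTerm

variable {Γ : Type*} [DecidableEq Γ] {q : Γ → ℕ}

/-- The local term `L_Z` as an operator on `A_Λ`, and `0` unless `Z ⊆ Λ`. -/
def localTerm (L : Interaction q) (Λ Z : Finset Γ) : Obs q Λ →L[ℂ] Obs q Λ :=
  if h : Z ⊆ Λ then LinearMap.toContinuousLinearMap (extend q h (L.term Z)) else 0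

theorem localTerm_apply (L : Interaction q) {Λ Z : Finset Γ} (h : Z ⊆ Λ) (B : Obs q Λ) :
    localTerm L Λ Z B = extend q h (L.term Z) B := by
  rw [localTerm, dif_pos h]
  rfl

theorem localTerm_of_not_subset (L : Interaction q) {Λ Z : Finset Γ} (h : ¬Z ⊆ Λ) :
    localTerm L Λ Z = 0 := dif_neg h

theorem generator_eq_sum (L : Interaction q) (Λ : Finset Γ) :
    generator L Λ = ∑ Z ∈ Λ.powerset, localTerm L Λ Z := by
  rw [generator, map_sum, ← Finset.sum_attach Λ.powerset (localTerm L Λ)]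
  refine Finset.sum_congr rfl fun Z _ => ?_
  rw [localTerm, dif_pos (Finset.mem_powerset.1 Z.2)]

theorem localTerm_commute (L : Interaction q) (Λ : Finset Γ) {Z Z' : Finset Γ}
    (hd : Disjoint Z Z') : Commute (localTerm L Λ Z) (localTerm L Λ Z') := by
  by_cases h : Z ⊆ Λ
  · by_cases h' : Z' ⊆ Λ
    · refine ContinuousLinearMap.ext fun B => ?_
      rw [mul_apply_eq_comp, mul_apply_eq_comp, localTerm_apply L h, localTerm_apply L h',
        localTerm_apply L h, localTerm_apply L h']
      exact extend_comm h h' hd (L.lindblad Z) (L.lindblad Z') B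
    · rw [localTerm_of_not_subset L h']
      exact Commute.zero_right _
  · rw [localTerm_of_not_subset L h]
    exact Commute.zero_left _

theorem localTerm_embed_of_disjoint (L : Interaction q) {X Λ Z : Finset Γ} (hX : X ⊆ Λ)
    (hd : Disjoint Z X) (A : Obs q X) : localTerm L Λ Z (embed q hX A) = 0 := by
  by_cases h : Z ⊆ Λ
  · rw [localTerm_apply L h]
    exact extend_embed_of_disjoint h hX hd (L.lindblad Z) A
  · rw [localTerm_of_not_subset L h]
    rfl

/-- Every partial sum of local terms generates a contraction semigroup. -/
theorem norm_exp_sum_localTerm_le (L : Interaction q) {Λ : Finset Γ} {S : Finset (Finset Γ)}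
    (hS : S ⊆ Λ.powerset) {t : ℝ} (ht : 0 ≤ t) (B : Obs q Λ) :
    ‖NormedSpace.exp ((t : ℂ) • ∑ Z ∈ S, localTerm L Λ Z) B‖ ≤ ‖B‖ := by
  refine norm_exp_smul_apply_le (fun B h hh => ?_) ht B
  rw [_root_.sum_apply]
  refine IsDissipative.norm_le (Φ := fun B => ∑ Z ∈ S, localTerm L Λ Z B)
    (IsDissipative.sum S fun Z hZ => ?_) B hh
  have h : Z ⊆ Λ := Finset.mem_powerset.1 (hS hZ)
  rw [funext (localTerm_apply L h)]
  exact ((L.lindblad Z).extend h).isDissipative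

/-- The dynamics of a subvolume, regarded as acting on the larger algebra. -/
theorem embed_dynamics (L : Interaction q) {Y Λ : Finset Γ} (h : Y ⊆ Λ) {t : ℝ} (ht : 0 ≤ t)
    (B : Obs q Y) :
    embed q h (dynamics L Y t B) =
      NormedSpace.exp ((t : ℂ) • ∑ Z ∈ Y.powerset, localTerm L Λ Z) (embed q h B) := by
  set G' := ∑ Z ∈ Y.powerset, localTerm L Λ Z with hG'
  let J : Obs q Y →L[ℂ] Obs q Λ :=
    LinearMap.toContinuousLinearMap (embedHom q h).toAlgHom.toLinearMap
  have hJ : ∀ B, J B = embed q h B := fun _ => rfl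
  have hint : ∀ B, J (generator L Y B) = G' (J B) := fun B => by
    rw [generator_eq_sum, hG', _root_.sum_apply, _root_.sum_apply, map_sum]
    refine Finset.sum_congr rfl fun Z hZ => ?_
    have hZ := Finset.mem_powerset.1 hZ
    rw [localTerm_apply L hZ, localTerm_apply L (hZ.trans h), hJ, hJ]
    exact embed_extend hZ h (L.lindblad Z) B
  -- Uniqueness for the linear equation: the difference of two solutions obeys the Duhamel estimate
  -- with zero forcing and zero bound.
  have key := norm_le_of_hasDerivAt_inhomogeneous (G := G')
    (u := fun s : ℝ => J (NormedSpace.exp ((s : ℂ) • generator L Y) B) -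
      NormedSpace.exp ((s : ℂ) • G') (J B)) (f := fun _ => 0) (b := fun _ => 0) (b' := fun _ => 0)
    (fun s hs => norm_exp_sum_localTerm_le L (Finset.powerset_mono.2 h) hs) (fun s => ?_)
    (fun s => hasDerivAt_const s 0)
    (by rw [exp_zero_smul_apply, exp_zero_smul_apply, sub_self, norm_zero])
    (fun _ _ => norm_zero.le) ht
  · exact sub_eq_zero.1 (norm_le_zero_iff.1 key)
  · have h1 := (J.restrictScalars ℝ).hasFDerivAt.comp_hasDerivAt s
      (hasDerivAt_exp_smul_apply (generator L Y) B s)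
    refine (h1.sub (hasDerivAt_exp_smul_apply G' (J B) s)).congr_deriv ?_
    rw [add_zero, map_sub, ← hint]
    rfl

/-- Comparison of the dynamics in two volumes, for any admissible constants. -/
theorem norm_dynamics_sub_dynamics_le [MetricSpace Γ] {F : ℝ → ℝ} (hF : IsDecayFunction Γ F)
    {L : Interaction q} (hL : interactionNorm F L < ⊤) {C : ℝ} (hC : 0 < C)
    {X Y Λ : Finset Γ} (hconv : ∀ x y, ∑ z ∈ Λ, F (dist x z) * F (dist z y) ≤ C * F (dist x y))
    (hXY : X ⊆ Y) (hY : Y ⊆ Λ) (A : Obs q X) {t : ℝ} (ht : 0 ≤ t) :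
    ‖dynamics L Λ t (embed q (hXY.trans hY) A) - embed q hY (dynamics L Y t (embed q hXY A))‖ ≤
      ‖A‖ * ((Real.exp ((interactionNorm F L).toReal * C * t) - 1) / C *
        ∑ x ∈ X, ∑ y ∈ Λ \ Y, F (dist x y)) := by
  have hf : ∀ x y : Γ, 0 ≤ F (dist x y) := fun x y => (hF.pos _ dist_nonneg).le
  rw [embed_dynamics L hY ht, embed_trans, dynamics, generator_eq_sum]
  refine (norm_evolution_sub_evolution_le (f := fun x y => F (dist x y)) (X := X)
    (a := fun Z => (cbNorm (L.term Z)).toReal) (M := (interactionNorm F L).toReal) (C := C)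
    (D := localTerm L Λ) (A := embed q (hXY.trans hY) A) hf
    (fun Z => ENNReal.toReal_nonneg) ENNReal.toReal_nonneg hC hconv (sum_cbNorm_le hF hL Λ)
    (fun Z hZ hZ0 B => ?_) (fun S hS t ht => norm_exp_sum_localTerm_le L hS ht)
    (fun Z Z' => localTerm_commute L Λ)
    (fun Z hd => localTerm_embed_of_disjoint L (hXY.trans hY) hd A) hY ht).trans ?_
  · rw [localTerm_apply L hZ]
    exact norm_extend_le hZ (cbNorm_ne_top hF hL hZ0) B
  · refine mul_le_mul_of_nonneg_right (norm_embed_le _ A) (mul_nonneg (div_nonneg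
      (sub_nonneg.2 (Real.one_le_exp (by positivity))) hC.le) ?_)
    exact Finset.sum_nonneg fun x _ => Finset.sum_nonneg fun y _ => hf x y

end LocalTerm

/-! ### Comparison with the stated constant, and conclusion -/

theorem exp_sub_one_div_le {M C N t : ℝ} (hM : 0 ≤ M) (hC : 0 < C) (hN : 0 ≤ N) (ht : 0 ≤ t) :
    (Real.exp (M * C * t) - 1) / C ≤
      M * (t + (C + N) / C * ∫ s in (0 : ℝ)..t, (Real.exp (M * C * s) - 1)) := by
  have hi : ∫ s in (0 : ℝ)..t, M * C * Real.exp (M * C * s) = Real.exp (M * C * t) - 1 := by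
    have := intervalIntegral.integral_eq_sub_of_hasDerivAt (a := 0) (b := t)
      (f := fun s => Real.exp (M * C * s)) (f' := fun s => M * C * Real.exp (M * C * s))
      (fun s _ => by simpa [mul_comm] using ((hasDerivAt_id s).const_mul (M * C)).exp)
      (Continuous.intervalIntegrable (by fun_prop) _ _)
    simpa only [mul_zero, Real.exp_zero] using this
  set I := ∫ s in (0 : ℝ)..t, (Real.exp (M * C * s) - 1) with hI
  have hI' : M * C * (t + I) = Real.exp (M * C * t) - 1 := by
    rw [← hi, intervalIntegral.integral_const_mul, hI, intervalIntegral.integral_sub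
      (Continuous.intervalIntegrable (by fun_prop) _ _)
      (Continuous.intervalIntegrable (by fun_prop) _ _)]
    simp
  have hI0 : 0 ≤ I := intervalIntegral.integral_nonneg ht fun s hs =>
    sub_nonneg.2 (Real.one_le_exp (mul_nonneg (mul_nonneg hM hC.le) hs.1))
  -- By `hI'` the left side equals `M (t + I)`; the factor in front of the integral only enlarges
  -- this.
  have h1 : 1 ≤ (C + N) / C := by rw [le_div_iff₀ hC]; linarith
  calc (Real.exp (M * C * t) - 1) / C = M * (t + 1 * I) := by rw [← hI']; field_simp
    _ ≤ _ := by gcongr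

end QSpin

end

theorem theorem2p8 {Γ : Type*} [MetricSpace Γ] [Countable Γ] [DecidableEq Γ]
    (q : Γ → ℕ) (F : ℝ → ℝ) (hF : QSpin.IsDecayFunction Γ F)
    (L : QSpin.Interaction q) (hL : QSpin.interactionNorm F L < ⊤)
    (X : Finset Γ) (A : QSpin.Obs q X) (Λ : Finset Γ) (hX : X ⊆ Λ)
    (t : ℝ) (ht : 0 ≤ t) (r : ℝ) (hr : 1 ≤ r) :
    ‖QSpin.dynamics L Λ t (QSpin.embed q hX A) -
        QSpin.embed q (QSpin.inflate_subset Λ X r)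
          (QSpin.dynamics L (QSpin.inflate Λ X r) t
            (QSpin.embed q (QSpin.subset_inflate hX hr) A))‖ ≤
      ‖A‖ * (QSpin.interactionNorm F L).toReal *
        (t + (QSpin.convConst Γ F + (QSpin.decayNorm Γ F).toReal) / QSpin.convConst Γ F *
          ∫ s in (0 : ℝ)..t,
            (Real.exp ((QSpin.interactionNorm F L).toReal * QSpin.convConst Γ F * s) - 1)) *
        ∑ x ∈ X, ∑ y ∈ Λ \ QSpin.inflate Λ X r, F (dist x y) := by
  have hXY := QSpin.subset_inflate hX hr
  have hY := QSpin.inflate_subset Λ X r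
  -- On an empty `Γ` every positive constant is admissible and `convConst` is `0`. For empty `X` any
  -- admissible `C` serves, since the sum over `X` vanishes.
  rcases X.eq_empty_or_nonempty with h | ⟨x₀, -⟩
  · obtain ⟨C, hC⟩ := hF.conv
    refine (QSpin.norm_dynamics_sub_dynamics_le hF hL hC.1
      (QSpin.IsConvBound.sum_le hF.pos hC Λ) hXY hY A ht).trans_eq ?_
    simp [h]
  · have : Nonempty Γ := ⟨x₀⟩
    have hC := hF.convConst_pos
    refine (QSpin.norm_dynamics_sub_dynamics_le hF hL hC (hF.sum_le Λ) hXY hY A ht).trans ?_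
    rw [← mul_assoc, mul_assoc ‖A‖ (QSpin.interactionNorm F L).toReal]
    have hP : 0 ≤ ∑ x ∈ X, ∑ y ∈ Λ \ QSpin.inflate Λ X r, F (dist x y) :=
      Finset.sum_nonneg fun x _ => Finset.sum_nonneg fun y _ => (hF.pos _ dist_nonneg).le
    refine mul_le_mul_of_nonneg_right (mul_le_mul_of_nonneg_left ?_ (norm_nonneg A)) hP
    exact QSpin.exp_sub_one_div_le ENNReal.toReal_nonneg hC ENNReal.toReal_nonneg ht
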